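/- Consider the congruence $$f^4-4g^2+4\equiv 0 \pmod{fg}\qquad(*)$$ for polynomials $f,g\in\mathbb{Q}[t]$. A solution $(f,g)$ with $f,g\neq 0$ and $m=\deg f$ is called *non-trivial* if the coefficient of $t^{m-1}$ in $f$ vanishes (no condition if $m=0$) and (a) there are no $f_1,g_1,h\in\mathbb{Q}[t]$ with $\deg h\ge 2$, $f=f_1\circ h$ and $g=g_1\circ h$; (b) the leading coefficient $a_m$ of $f$ satisfies $|\nu_p(a_m)|<m$ for every prime $p$, where $\nu_p$ is the $p$-adic valuation. Put $P(t)=\tfrac12(t^2+2t+2)$ and $Q(t)=\tfrac14(t^2+2t+2)(t^2-2t+2)$; the pairs $(t,P)$ and $(t,Q)$ are solutions of $(*)$. Then: 1. There is no non-trivial solution $(f,g)$ of $(*)$ with $\deg f=2$. 2. For $n\in\{1,2,3,5,6,7\}$ there is no solution $(f,g)$ of $(*)$ at all with $\deg f=2$ and $\deg g=n$. 3. If $\deg f=2$ and $\deg g=4$, then $(f,g)$ solves $(*)$ if and only if $g=\pm P(f)$ or $g=\pm P(-f)$. 4. If $\deg f=2$ and $\deg g=8$, then $(f,g)$ solves $(*)$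 if and only if $g=\pm Q(f)$. -/

import Mathlib

open Polynomial

/-- The pair `(f, g)` of rational polynomials solves `f⁴ - 4g² + 4 ≡ 0 (mod fg)`. -/
def IsQuarticSolution (f g : ℚ[X]) : Prop :=
  f * g ∣ f ^ 4 - 4 * g ^ 2 + 4

/-- Both members of the pair `(f, g)` are polynomials in one and the same polynomial `h`
of degree at least two. -/
def IsProperComposition (f g : ℚ[X]) : Prop :=
  ∃ f₁ g₁ h : ℚ[X], 2 ≤ h.natDegree ∧ f = f₁.comp h ∧ g = g₁.comp h

/-- Non-trivial solutions: with `m = deg f`, the polynomial `f` has no term of degree `m - 1`,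
the pair is not a proper composition, and the leading coefficient of `f` has, at every prime,
a valuation of absolute value less than `m`. -/
structure IsNontrivialQuarticSolution (f g : ℚ[X]) : Prop where
  ne_zero_left : f ≠ 0
  ne_zero_right : g ≠ 0
  solution : IsQuarticSolution f g
  normalized : ∀ i : ℕ, i + 1 = f.natDegree → f.coeff i = 0
  not_composition : ¬ IsProperComposition f g
  leadingCoeff_free : ∀ p : ℕ, p.Prime → |padicValRat p f.leadingCoeff| < (f.natDegree : ℤ)

/-- The polynomial `P = (t² + 2t + 2) / 2`; the pair `(t, P)` is a solution. -/
noncomputable def quarticBaseP : ℚ[X] :=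
  C (1 / 2) * (X ^ 2 + 2 * X + 2)

/-- The polynomial `Q = (t² + 2t + 2)(t² - 2t + 2) / 4 = (t⁴ + 4) / 4`; the pair `(t, Q)` is a
solution. -/
noncomputable def quarticBaseQ : ℚ[X] :=
  C (1 / 4) * ((X ^ 2 + 2 * X + 2) * (X ^ 2 - 2 * X + 2))

/-! The congruence gives f ∣ g² − 1 and g ∣ f⁴ + 4 = ((f + 1)² + 1)((f − 1)² + 1). After a
translation a quadratic f is a(X² − d), and g = GH with G and H dividing the two factors. These
factors have no rational root, so each of G, H is constant, a constant multiple of the full factor,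
or quadratic (`dvd_quadratic_sq_add_one`). Modulo f one has g ≡ α + βX with X² ≡ d, and g² ≡ 1 means
αβ = 0 and α² + dβ² = 1. This excludes every case with a quadratic G or H
(`false_of_quadratic_factor`, `false_of_two_quadratic_factors`). Hence g is always a polynomial in
f: the choice h = f violates non-triviality, and the degree of g separates constants, ±P(±f) and
±Q(f). -/

/-! ### Divisors of (aX² + e)² + 1 -/

lemma quadratic_sq_add_one_eval_ne_zero (a e x : ℚ) :
    ((C a * X ^ 2 + C e) ^ 2 + 1 : ℚ[X]).eval x ≠ 0 := by
  simp only [eval_add, eval_pow, eval_mul, eval_C, eval_X, eval_one]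
  positivity

lemma natDegree_ne_one_of_dvd_quadratic_sq_add_one {a e : ℚ} {G : ℚ[X]}
    (h : G ∣ (C a * X ^ 2 + C e) ^ 2 + 1) : G.natDegree ≠ 1 := by
  intro hG
  obtain ⟨x, hx⟩ := exists_root_of_degree_eq_one
    (degree_eq_iff_natDegree_eq_of_pos one_pos |>.2 hG)
  exact quadratic_sq_add_one_eval_ne_zero a e x (hx.dvd h)

lemma natDegree_quadratic_sq_add_one {a : ℚ} (ha : a ≠ 0) (e : ℚ) :
    ((C a * X ^ 2 + C e) ^ 2 + 1 : ℚ[X]).natDegree = 4 := by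
  have : ((C a * X ^ 2 + C e) ^ 2 + 1 : ℚ[X])
      = C (a ^ 2) * X ^ 4 + C (2 * a * e) * X ^ 2 + C (e ^ 2 + 1) := by
    simp only [C_mul, C_pow, C_add, C_1, C_ofNat]; ring
  rw [this]
  compute_degree!

/-- The coefficients of a quadratic factor `X² + pX + q` of `(aX² + e)² + 1`. -/
lemma exists_sq_add_sq_of_factor {a e p q h₀ : ℚ} (ha : a ≠ 0)
    (h2 : h₀ - p * (p * a ^ 2) + q * a ^ 2 = 2 * a * e)
    (h1 : p * h₀ - q * (p * a ^ 2) = 0) (h0 : q * h₀ = e ^ 2 + 1) :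
    ∃ u v : ℚ, 2 * a * u * v = -1 ∧ a * (u ^ 2 - v ^ 2) = -e ∧ p = 2 * u ∧
      q = u ^ 2 + v ^ 2 := by
  have hp : p ≠ 0 := by
    rintro rfl
    have : (q * a - e) ^ 2 = -1 := by linear_combination q * h2 - h0
    linarith [sq_nonneg (q * a - e)]
  have hh : h₀ = q * a ^ 2 := by
    apply mul_left_cancel₀ hp
    linear_combination h1
  subst hh
  have hap : a * p ^ 2 = 2 * (q * a - e) := by
    apply mul_left_cancel₀ ha
    linear_combination -h2
  have hinv : a * p * (1 / (a * p)) = 1 := by field_simp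
  -- The roots are −u ± iv, with aX² + e = i at −u + iv. Its imaginary part reads −2auv = 1, which
  -- fixes v once u = p/2.
  refine ⟨p / 2, -(1 / (a * p)), by linear_combination -hinv, ?_, by ring, ?_⟩
  · field_simp
    linear_combination (a * p ^ 2 + 2 * (q * a - e) + 4 * e) * hap + 4 * h0
  · field_simp
    linear_combination (-a * p ^ 2 - 2 * (q * a - e) + 4 * q * a) * hap + 4 * h0

/-- The divisors of `(aX² + e)² + 1` over `ℚ`. -/
lemma dvd_quadratic_sq_add_one {a e : ℚ} (ha : a ≠ 0) {G : ℚ[X]}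
    (h : G ∣ (C a * X ^ 2 + C e) ^ 2 + 1) :
    ∃ k : ℚ, G = C k ∨ G = C k * ((C a * X ^ 2 + C e) ^ 2 + 1) ∨
      ∃ u v : ℚ, 2 * a * u * v = -1 ∧ a * (u ^ 2 - v ^ 2) = -e ∧
        G = C k * (X ^ 2 + C (2 * u) * X + C (u ^ 2 + v ^ 2)) := by
  obtain ⟨H, hH⟩ := h
  have hdeg := natDegree_quadratic_sq_add_one ha e
  have hGH : G * H ≠ 0 := by
    rw [← hH]
    intro h
    simp [h] at hdeg
  have hG1 := natDegree_ne_one_of_dvd_quadratic_sq_add_one (Dvd.intro H hH.symm)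
  have hH1 := natDegree_ne_one_of_dvd_quadratic_sq_add_one (Dvd.intro_left G hH.symm)
  rw [hH, natDegree_mul (left_ne_zero_of_mul hGH) (right_ne_zero_of_mul hGH)] at hdeg
  obtain hG | hG | hG : G.natDegree = 0 ∨ H.natDegree = 0 ∨ G.natDegree = 2 := by omega
  · exact ⟨G.coeff 0, Or.inl (eq_C_of_natDegree_eq_zero hG)⟩
  · obtain ⟨k, rfl⟩ := natDegree_eq_zero.1 hG
    have hk : k ≠ 0 := by
      rintro rfl
      simp at hGH
    refine ⟨k⁻¹, Or.inr (Or.inl ?_)⟩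
    rw [hH, mul_left_comm, ← C_mul, inv_mul_cancel₀ hk, C_1, mul_one]
  · have hH2 : H.natDegree = 2 := by omega
    have hg : G.coeff 2 ≠ 0 := by
      rw [← hG]
      exact leadingCoeff_ne_zero.2 (left_ne_zero_of_mul hGH)
    have eG := eq_quadratic_of_degree_le_two (natDegree_le_iff_degree_le.1 hG.le)
    have eH := eq_quadratic_of_degree_le_two (natDegree_le_iff_degree_le.1 hH2.le)
    generalize G.coeff 2 = g₂ at *
    generalize G.coeff 1 = g₁ at *
    generalize G.coeff 0 = g₀ at *
    generalize H.coeff 2 = h₂ at *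
    generalize H.coeff 1 = h₁ at *
    generalize H.coeff 0 = h₀ at *
    have ev : ∀ x : ℚ, (a * x ^ 2 + e) ^ 2 + 1
        = (g₂ * x ^ 2 + g₁ * x + g₀) * (h₂ * x ^ 2 + h₁ * x + h₀) := by
      intro x
      have := congrArg (eval x) hH
      rw [eG, eH] at this
      simpa using this
    -- Five values determine the coefficients of a quartic.
    have e0 := ev 0
    have e1 := ev 1
    have e2 := ev (-1)
    have e3 := ev 2
    have e4 := ev (-2)
    have c4 : g₂ * h₂ = a ^ 2 := by linarith
    have c3 : g₂ * h₁ + g₁ * h₂ = 0 := by linarith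
    have c2 : g₂ * h₀ + g₁ * h₁ + g₀ * h₂ = 2 * a * e := by linarith
    have c1 : g₁ * h₀ + g₀ * h₁ = 0 := by linarith
    have c0 : g₀ * h₀ = e ^ 2 + 1 := by linarith
    obtain ⟨p, rfl⟩ : ∃ p, g₁ = g₂ * p := ⟨g₁ / g₂, by field_simp⟩
    obtain ⟨q, rfl⟩ : ∃ q, g₀ = g₂ * q := ⟨g₀ / g₂, by field_simp⟩
    obtain ⟨u, v, huv, he, rfl, rfl⟩ := exists_sq_add_sq_of_factor (e := e) (p := p) (q := q)
      (h₀ := g₂ * h₀) ha (by linear_combination c2 - p * c3 + (p ^ 2 - q) * c4)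
      (by linear_combination c1 - q * c3 + 2 * p * q * c4 - p * q * c4) (by linear_combination c0)
    refine ⟨g₂, Or.inr (Or.inr ⟨u, v, huv, he, ?_⟩)⟩
    rw [eG]
    simp only [C_mul]
    ring

/-! ### Residues modulo a(X² − d) -/

/-- A polynomial of square one modulo `aX² + c` which is congruent to `α + βX`. -/
lemma sq_eq_one_of_congr_linear {a d α β : ℚ} (ha : a ≠ 0) {g : ℚ[X]}
    (hg : C a * X ^ 2 - C (a * d) ∣ g ^ 2 - 1)
    (hl : C a * X ^ 2 - C (a * d) ∣ g - (C α + C β * X)) :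
    α * β = 0 ∧ α ^ 2 + d * β ^ 2 = 1 := by
  have hlin : C a * X ^ 2 - C (a * d) ∣ C (2 * α * β) * X + C (α ^ 2 + d * β ^ 2 - 1) := by
    have h1 := hg.sub (hl.mul_right (g + (C α + C β * X)))
    have h2 : C a * X ^ 2 - C (a * d) ∣ (C a * X ^ 2 - C (a * d)) * C (a⁻¹ * β ^ 2) :=
      dvd_mul_right _ _
    convert h1.sub h2 using 1
    have hi : (C a * C a⁻¹ : ℚ[X]) = 1 := by rw [← C_mul, mul_inv_cancel₀ ha, C_1]
    simp only [C_mul, C_add, C_sub, C_pow, C_1, C_ofNat]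
    linear_combination (X ^ 2 - C d) * C β ^ 2 * hi
  have hz := eq_zero_of_dvd_of_natDegree_lt hlin (by
    have : (C a * X ^ 2 - C (a * d) : ℚ[X]).natDegree = 2 := by compute_degree!
    rw [this]
    exact natDegree_linear_le.trans_lt one_lt_two)
  have hcoeff : ∀ s t : ℚ, C s * X + C t = 0 → s = 0 ∧ t = 0 := fun s t h ↦
    ⟨by simpa using congrArg (coeff · 1) h, by simpa using congrArg (coeff · 0) h⟩
  obtain ⟨h1, h0⟩ := hcoeff _ _ hz
  exact ⟨by linarith, by linarith⟩

/-- Since X² ≡ d, linear residues multiply as in ℚ[√d]; the residue of GH thus follows from those of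
G and H. -/
lemma mul_congr_linear {a d : ℚ} (ha : a ≠ 0) {G H : ℚ[X]} {α β α' β' : ℚ}
    (hG : C a * X ^ 2 - C (a * d) ∣ G - (C α + C β * X))
    (hH : C a * X ^ 2 - C (a * d) ∣ H - (C α' + C β' * X)) :
    C a * X ^ 2 - C (a * d) ∣
      G * H - (C (α * α' + d * β * β') + C (α * β' + β * α') * X) := by
  have h1 := (hG.mul_right H).add (hH.mul_right (C α + C β * X))
  have h2 : C a * X ^ 2 - C (a * d) ∣ (C a * X ^ 2 - C (a * d)) * C (a⁻¹ * β * β') :=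
    dvd_mul_right _ _
  convert h1.add h2 using 1
  have hi : (C a * C a⁻¹ : ℚ[X]) = 1 := by rw [← C_mul, mul_inv_cancel₀ ha, C_1]
  simp only [C_mul, C_add]
  linear_combination -(X ^ 2 - C d) * C β * C β' * hi

/-! ### Exclusion of quadratic factors -/

/-- A quadratic factor of one of `(f ± 1)² + 1`, up to a constant, never has square one
modulo `f`. -/
lemma false_of_quadratic_factor {u v d k : ℚ} (hu : u ≠ 0) (hd : d = u ^ 2 - v ^ 2 - 2 * u * v)
    (h1 : k * (d + u ^ 2 + v ^ 2) * (k * (2 * u)) = 0)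
    (h2 : (k * (d + u ^ 2 + v ^ 2)) ^ 2 + d * (k * (2 * u)) ^ 2 = 1) : False := by
  subst hd
  have hk : k ≠ 0 := by
    rintro rfl
    norm_num at h2
  -- Here d + u² + v² = 2u(u − v), and β = 2ku ≠ 0, so α must vanish. Then d = −2u² < 0, against dβ²
  -- = 1.
  have huv : u = v := by
    have : (4 * k ^ 2 * u ^ 2) * (u - v) = 0 := by linear_combination h1
    have := (mul_eq_zero.1 this).resolve_left (by positivity)
    linarith
  subst huv
  have : 0 ≤ k ^ 2 * u ^ 4 := by positivity
  nlinarith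

/-- A product of quadratic factors of `(f + 1)² + 1` and `(f - 1)² + 1`, up to a constant,
never has square one modulo `f`. -/
lemma false_of_two_quadratic_factors {u v w z d k : ℚ} (hu : u ≠ 0) (hv : v ≠ 0)
    (huv : u * v = w * z) (hd : d = u ^ 2 - v ^ 2 - 2 * u * v)
    (hd' : d = w ^ 2 - z ^ 2 + 2 * w * z)
    (h1 : (k * (2 * u * (u - v) * (2 * w * (w + z)) + d * (2 * u) * (2 * w))) *
      (k * (2 * u * (u - v) * (2 * w) + 2 * u * (2 * w * (w + z)))) = 0)
    (h2 : (k * (2 * u * (u - v) * (2 * w * (w + z)) + d * (2 * u) * (2 * w))) ^ 2 +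
      d * (k * (2 * u * (u - v) * (2 * w) + 2 * u * (2 * w * (w + z)))) ^ 2 = 1) : False := by
  have hk : k ≠ 0 := by
    rintro rfl
    norm_num at h2
  have hw : w ≠ 0 := by
    rintro rfl
    simp [hu, hv] at huv
  rcases mul_eq_zero.1 h1 with h | h
  · have hxd : d = -(u - v) * (w + z) := by
      have : (4 * k * u * w) * ((u - v) * (w + z) + d) = 0 := by linear_combination h
      have := (mul_eq_zero.1 this).resolve_left (by positivity)
      linarith
    rw [h] at h2
    have hdpos : 0 < d := by
      by_contra hneg
      have := mul_nonneg (neg_nonneg.2 (not_lt.1 hneg))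
        (sq_nonneg (k * (2 * u * (u - v) * (2 * w) + 2 * u * (2 * w * (w + z)))))
      linarith
    -- Case α = 0, where dβ² = 1 forces d > 0. Both xy and x² − y² are expressible in u and v;
    -- eliminating x and y leaves a relation whose left side is positive.
    obtain ⟨x, hx⟩ : ∃ x, x = w + z := ⟨_, rfl⟩
    obtain ⟨y, hy⟩ : ∃ y, y = w - z := ⟨_, rfl⟩
    have hxy : x * y = u ^ 2 - v ^ 2 - 4 * u * v := by
      subst hx hy
      linear_combination hd - hd' + 2 * huv
    have hsq : x ^ 2 - y ^ 2 = 4 * u * v := by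
      subst hx hy
      linear_combination -4 * huv
    have hxd' : x * (u - v) = -d := by
      subst hx
      linear_combination hxd
    have key : d ^ 4 - (u ^ 2 - v ^ 2 - 4 * u * v) ^ 2 * (u - v) ^ 4
        = 4 * u * v * d ^ 2 * (u - v) ^ 2 := by
      have hdd : d = -(x * (u - v)) := by linarith
      rw [← hxy, hdd]
      linear_combination x ^ 2 * (u - v) ^ 4 * hsq
    have key' : (8 * u ^ 2 * v ^ 2) * (d * ((u - 2 * v) ^ 2 + v ^ 2) + 2 * v ^ 4) = 0 := by
      rw [hd] at key ⊢
      linear_combination -key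
    have hpos : 0 < d * ((u - 2 * v) ^ 2 + v ^ 2) + 2 * v ^ 4 := by positivity
    have hpos' : 0 < 8 * u ^ 2 * v ^ 2 := by positivity
    exact (mul_pos hpos' hpos).ne' key'
  · have hs : u + w = v - z := by
      have : (4 * k * u * w) * (u - v + w + z) = 0 := by linear_combination h
      have := (mul_eq_zero.1 this).resolve_left (by positivity)
      linarith
    obtain rfl : z = v - u - w := by linarith
    -- Case β = 0. With s = u + w, both s(u − v) and s(u + v − s) equal 2uv, so s = 2v and then v =
    -- 0.
    have e1 : (u + w) * (u - v) = 2 * u * v := by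
      linear_combination (hd' - hd) / 2 - huv
    have e2 : (u + w) * (u + v - (u + w)) = 2 * u * v := by linear_combination -huv
    have hsne : u + w ≠ 0 := by
      intro h0
      rw [h0, zero_mul] at e1
      exact mul_ne_zero (mul_ne_zero two_ne_zero hu) hv e1.symm
    have : u - v = u + v - (u + w) := mul_left_cancel₀ hsne (e1.trans e2.symm)
    obtain rfl : w = 2 * v - u := by linarith
    have : 2 * v ^ 2 = 0 := by linear_combination -e1
    exact hv (by simpa using this)

/-! ### Classification for quadratic f -/

lemma IsQuarticSolution.dvd_sq_sub_one {f g : ℚ[X]} (h : IsQuarticSolution f g) :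
    f ∣ g ^ 2 - 1 := by
  have h1 : f ∣ f ^ 4 - (f ^ 4 - 4 * g ^ 2 + 4) :=
    (dvd_pow_self f four_ne_zero).sub ((dvd_mul_right f g).trans h)
  have h2 := h1.mul_left (C (1 / 4))
  convert h2 using 1
  have : (C (1 / 4) * 4 : ℚ[X]) = 1 := by
    rw [← C_ofNat, ← C_mul]; norm_num
  linear_combination -(g ^ 2 - 1) * this

lemma IsQuarticSolution.dvd_mul {f g : ℚ[X]} (h : IsQuarticSolution f g) :
    g ∣ ((f + 1) ^ 2 + 1) * ((f - 1) ^ 2 + 1) := by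
  have h1 := ((dvd_mul_left g f).trans h).add (dvd_mul_right g (4 * g))
  convert h1 using 1
  ring

/-- The explicit list of the polynomials `g` which solve the congruence with `f`. -/
def IsListedPartner (f g : ℚ[X]) : Prop :=
  ∃ k : ℚ, (k ^ 2 = 1 ∧ g = C k) ∨
    (4 * k ^ 2 = 1 ∧ g = C k * ((f + 1) ^ 2 + 1)) ∨
    (4 * k ^ 2 = 1 ∧ g = C k * ((f - 1) ^ 2 + 1)) ∨
    (16 * k ^ 2 = 1 ∧ g = C k * (((f + 1) ^ 2 + 1) * ((f - 1) ^ 2 + 1)))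

lemma IsQuarticSolution.isListedPartner_of_pure {a d : ℚ} (ha : a ≠ 0) {g : ℚ[X]}
    (h : IsQuarticSolution (C a * X ^ 2 - C (a * d)) g) :
    IsListedPartner (C a * X ^ 2 - C (a * d)) g := by
  have hsq := h.dvd_sq_sub_one
  obtain ⟨G, H, hG, hH, rfl⟩ := exists_dvd_and_dvd_of_dvd_mul h.dvd_mul
  have eG : (C a * X ^ 2 - C (a * d) + 1 : ℚ[X]) = C a * X ^ 2 + C (1 - a * d) := by
    rw [C_sub, C_1]; ring
  have eH : (C a * X ^ 2 - C (a * d) - 1 : ℚ[X]) = C a * X ^ 2 + C (-1 - a * d) := by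
    rw [C_sub, C_neg, C_1]; ring
  have hi : (C a * C a⁻¹ : ℚ[X]) = 1 := by rw [← C_mul, mul_inv_cancel₀ ha, C_1]
  have const : ∀ k, C a * X ^ 2 - C (a * d) ∣ C k - (C k + C 0 * X) := by simp
  -- For s = ±1 the full factor (f + s)² + 1 is congruent to 2 modulo f, whence the conditions 4k² =
  -- 1 and 16k² = 1.
  have whole : ∀ k, ∀ s : ℚ[X], s ^ 2 = 1 → C a * X ^ 2 - C (a * d) ∣
      C k * ((C a * X ^ 2 - C (a * d) + s) ^ 2 + 1) - (C (k * 2) + C 0 * X) := by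
    intro k s hs
    refine ⟨C k * (C a * X ^ 2 - C (a * d) + 2 * s), ?_⟩
    simp only [C_mul, C_0, C_ofNat]
    linear_combination C k * hs
  have quad : ∀ k u t : ℚ, C a * X ^ 2 - C (a * d) ∣
      C k * (X ^ 2 + C (2 * u) * X + C t) - (C (k * (d + t)) + C (k * (2 * u)) * X) := by
    intro k u t
    refine ⟨C (k * a⁻¹), ?_⟩
    simp only [C_mul, C_add]
    linear_combination -(C k * (X ^ 2 - C d)) * hi
  have hG' := hG
  have hH' := hH
  rw [eG] at hG'
  rw [eH] at hH'
  have quadG : ∀ u v : ℚ, 2 * a * u * v = -1 → a * (u ^ 2 - v ^ 2) = -(1 - a * d) →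
      u ≠ 0 ∧ v ≠ 0 ∧ d = u ^ 2 - v ^ 2 - 2 * u * v := by
    intro u v h1 h2
    refine ⟨by rintro rfl; norm_num at h1, by rintro rfl; norm_num at h1, ?_⟩
    apply mul_left_cancel₀ ha
    linear_combination h1 - h2
  have quadH : ∀ u v : ℚ, 2 * a * u * v = -1 → a * (u ^ 2 - v ^ 2) = -(-1 - a * d) →
      u ≠ 0 ∧ d = u ^ 2 - v ^ 2 + 2 * u * v := by
    intro u v h1 h2
    refine ⟨by rintro rfl; norm_num at h1, ?_⟩
    apply mul_left_cancel₀ ha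
    linear_combination -h1 - h2
  obtain ⟨k, hk | hk | ⟨u, v, h1, h2, hk⟩⟩ := dvd_quadratic_sq_add_one ha hG' <;>
  obtain ⟨l, hl | hl | ⟨w, z, h3, h4, hl⟩⟩ := dvd_quadratic_sq_add_one ha hH' <;>
  (try rw [← eG] at hk) <;> (try rw [← eH] at hl) <;> subst hk <;> subst hl
  · obtain ⟨-, h⟩ := sq_eq_one_of_congr_linear ha hsq (mul_congr_linear ha (const _) (const _))
    exact ⟨k * l, Or.inl ⟨by linear_combination h, by rw [C_mul]⟩⟩
  · obtain ⟨-, h⟩ := sq_eq_one_of_congr_linear ha hsq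
      (mul_congr_linear ha (const _) (whole l (-1) (by ring)))
    exact ⟨k * l, Or.inr (Or.inr (Or.inl ⟨by linear_combination h, by simp only [C_mul]; ring⟩))⟩
  · obtain ⟨hu, hd⟩ := quadH w z h3 h4
    obtain ⟨h, h'⟩ := sq_eq_one_of_congr_linear ha hsq (mul_congr_linear ha (const _) (quad _ _ _))
    -- Factors of (f − 1)² + 1 satisfy d = w² − z² + 2wz, which is the relation for (f + 1)² + 1
    -- with z negated.
    exact (false_of_quadratic_factor (d := d) (v := -z) (k := k * l) hu (by linear_combination hd)
      (by linear_combination h) (by linear_combination h')).elim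
  · obtain ⟨-, h⟩ := sq_eq_one_of_congr_linear ha hsq
      (mul_congr_linear ha (whole k 1 (by ring)) (const _))
    exact ⟨k * l, Or.inr (Or.inl ⟨by linear_combination h, by simp only [C_mul]; ring⟩)⟩
  · obtain ⟨-, h⟩ := sq_eq_one_of_congr_linear ha hsq
      (mul_congr_linear ha (whole k 1 (by ring)) (whole l (-1) (by ring)))
    exact ⟨k * l, Or.inr (Or.inr (Or.inr ⟨by linear_combination h, by simp only [C_mul]; ring⟩))⟩
  · obtain ⟨hu, hd⟩ := quadH w z h3 h4
    obtain ⟨h, h'⟩ := sq_eq_one_of_congr_linear ha hsq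
      (mul_congr_linear ha (whole k 1 (by ring)) (quad _ _ _))
    exact (false_of_quadratic_factor (d := d) (v := -z) (k := 2 * k * l) hu (by linear_combination hd)
      (by linear_combination h) (by linear_combination h')).elim
  · obtain ⟨hu, -, hd⟩ := quadG u v h1 h2
    obtain ⟨h, h'⟩ := sq_eq_one_of_congr_linear ha hsq (mul_congr_linear ha (quad _ _ _) (const _))
    exact (false_of_quadratic_factor (d := d) (k := k * l) hu hd
      (by linear_combination h) (by linear_combination h')).elim
  · obtain ⟨hu, -, hd⟩ := quadG u v h1 h2
    obtain ⟨h, h'⟩ := sq_eq_one_of_congr_linear ha hsq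
      (mul_congr_linear ha (quad _ _ _) (whole l (-1) (by ring)))
    exact (false_of_quadratic_factor (d := d) (k := 2 * k * l) hu hd
      (by linear_combination h) (by linear_combination h')).elim
  · obtain ⟨hu, hv, hd⟩ := quadG u v h1 h2
    obtain ⟨-, hd'⟩ := quadH w z h3 h4
    obtain ⟨h, h'⟩ := sq_eq_one_of_congr_linear ha hsq (mul_congr_linear ha (quad _ _ _) (quad _ _ _))
    have hA : d + (u ^ 2 + v ^ 2) = 2 * u * (u - v) := by linear_combination hd
    have hB : d + (w ^ 2 + z ^ 2) = 2 * w * (w + z) := by linear_combination hd'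
    rw [hA, hB] at h h'
    have huw : u * v = w * z := by
      apply mul_left_cancel₀ (mul_ne_zero two_ne_zero ha)
      linear_combination h1 - h3
    exact (false_of_two_quadratic_factors (d := d) (k := k * l) hu hv huw hd hd'
      (by linear_combination h) (by linear_combination h')).elim

lemma IsQuarticSolution.comp {f g : ℚ[X]} (h : IsQuarticSolution f g) (p : ℚ[X]) :
    IsQuarticSolution (f.comp p) (g.comp p) := by
  have := map_dvd (compRingHom p) h
  simpa [IsQuarticSolution] using this

lemma IsListedPartner.comp {f g : ℚ[X]} (h : IsListedPartner f g) (p : ℚ[X]) :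
    IsListedPartner (f.comp p) (g.comp p) := by
  obtain ⟨k, h⟩ := h
  refine ⟨k, ?_⟩
  rcases h with ⟨hk, rfl⟩ | ⟨hk, rfl⟩ | ⟨hk, rfl⟩ | ⟨hk, rfl⟩ <;> simp [hk]

/-- All solutions of the congruence with a quadratic `f`. -/
lemma IsQuarticSolution.isListedPartner {f g : ℚ[X]} (hf : f.natDegree = 2)
    (h : IsQuarticSolution f g) : IsListedPartner f g := by
  have ha : f.coeff 2 ≠ 0 := by
    rw [← hf]
    refine leadingCoeff_ne_zero.2 ?_
    rintro rfl
    simp at hf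
  have ef := eq_quadratic_of_degree_le_two (natDegree_le_iff_degree_le.1 hf.le)
  generalize f.coeff 2 = a at *
  generalize f.coeff 1 = b at *
  generalize f.coeff 0 = c at *
  obtain ⟨r, rfl⟩ : ∃ r, b = 2 * a * r := ⟨b / (2 * a), by field_simp⟩
  obtain ⟨d, rfl⟩ : ∃ d, c = a * r ^ 2 - a * d := ⟨r ^ 2 - c / a, by field_simp; ring⟩
  have hcomp : f.comp (X - C r) = C a * X ^ 2 - C (a * d) := by
    rw [ef]
    simp only [add_comp, sub_comp, mul_comp, C_comp, pow_comp, X_comp, ofNat_comp, C_mul, C_sub,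
      C_pow, C_ofNat]
    ring
  have h1 := h.comp (X - C r)
  rw [hcomp] at h1
  have h2 := (h1.isListedPartner_of_pure ha).comp (X + C r)
  rw [← hcomp] at h2
  simpa [comp_assoc] using h2

/-! ### The solutions coming from P and Q -/

lemma quarticBaseP_comp (f : ℚ[X]) : quarticBaseP.comp f = C (1 / 2) * ((f + 1) ^ 2 + 1) := by
  simp only [quarticBaseP, mul_comp, C_comp, add_comp, pow_comp, X_comp, ofNat_comp]
  ring

lemma quarticBaseP_comp_neg (f : ℚ[X]) :
    quarticBaseP.comp (-f) = C (1 / 2) * ((f - 1) ^ 2 + 1) := by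
  rw [quarticBaseP_comp]; ring

lemma quarticBaseQ_comp (f : ℚ[X]) :
    quarticBaseQ.comp f = C (1 / 4) * (((f + 1) ^ 2 + 1) * ((f - 1) ^ 2 + 1)) := by
  simp only [quarticBaseQ, mul_comp, C_comp, add_comp, sub_comp, pow_comp, X_comp, ofNat_comp]
  ring

lemma IsListedPartner.eq_base {f g : ℚ[X]} (h : IsListedPartner f g) :
    (∃ k, g = C k) ∨ (g = quarticBaseP.comp f ∨ g = -quarticBaseP.comp f ∨
      g = quarticBaseP.comp (-f) ∨ g = -quarticBaseP.comp (-f)) ∨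
      (g = quarticBaseQ.comp f ∨ g = -quarticBaseQ.comp f) := by
  rw [quarticBaseP_comp_neg, quarticBaseP_comp f, quarticBaseQ_comp]
  simp only [← neg_mul, ← C_neg]
  have half : ∀ k : ℚ, 4 * k ^ 2 = 1 → k = 1 / 2 ∨ k = -(1 / 2) := fun k hk ↦
    sq_eq_sq_iff_eq_or_eq_neg.1 (by linarith)
  have quarter : ∀ k : ℚ, 16 * k ^ 2 = 1 → k = 1 / 4 ∨ k = -(1 / 4) := fun k hk ↦
    sq_eq_sq_iff_eq_or_eq_neg.1 (by linarith)
  obtain ⟨k, ⟨-, rfl⟩ | ⟨hk, rfl⟩ | ⟨hk, rfl⟩ | ⟨hk, rfl⟩⟩ := h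
  · exact Or.inl ⟨k, rfl⟩
  · rcases half k hk with rfl | rfl <;> simp
  · rcases half k hk with rfl | rfl <;> simp
  · rcases quarter k hk with rfl | rfl <;> simp

lemma IsQuarticSolution.neg_right {f g : ℚ[X]} (h : IsQuarticSolution f g) :
    IsQuarticSolution f (-g) := by
  simpa [IsQuarticSolution] using h

lemma IsQuarticSolution.neg_left {f g : ℚ[X]} (h : IsQuarticSolution f g) :
    IsQuarticSolution (-f) g := by
  have : (-f) ^ 4 = f ^ 4 := by ring
  simpa [IsQuarticSolution, this] using h

lemma isQuarticSolution_baseP (f : ℚ[X]) : IsQuarticSolution f (quarticBaseP.comp f) := by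
  -- With A = (f + 1)² + 1 = 2g and B = (f − 1)² + 1, the value is AB − A² = −4fA = −8fg.
  refine ⟨-8, ?_⟩
  have h : (C (1 / 2) * 2 : ℚ[X]) = 1 := by
    rw [← C_ofNat, ← C_mul]; norm_num
  rw [quarticBaseP_comp]
  generalize (C (1 / 2) : ℚ[X]) = t at *
  linear_combination (-((f + 1) ^ 2 + 1) ^ 2 * (t * 2 + 1)
    + 4 * f * ((f + 1) ^ 2 + 1)) * h

lemma isQuarticSolution_baseQ (f : ℚ[X]) : IsQuarticSolution f (quarticBaseQ.comp f) := by
  -- Here f⁴ + 4 = 4g, so the value is 4g(1 − g) = −f⁴g.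
  refine ⟨-f ^ 3, ?_⟩
  have h : (C (1 / 4) * 4 : ℚ[X]) = 1 := by
    rw [← C_ofNat, ← C_mul]; norm_num
  rw [quarticBaseQ_comp]
  generalize (C (1 / 4) : ℚ[X]) = t at *
  linear_combination (-(f ^ 4 + 4) * t * (f ^ 4 + 4) - (f ^ 4 + 4)) * h

lemma natDegree_quarticBaseP : quarticBaseP.natDegree = 2 := by
  unfold quarticBaseP
  rw [natDegree_C_mul (by norm_num)]
  compute_degree!

lemma natDegree_quarticBaseQ : quarticBaseQ.natDegree = 4 := by
  have : quarticBaseQ = C (1 / 4) * (X ^ 4 + 4) := by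
    unfold quarticBaseQ; ring
  rw [this, natDegree_C_mul (by norm_num)]
  compute_degree!

theorem mainTheorem6 :
    (¬ ∃ f g : ℚ[X], f.natDegree = 2 ∧ IsNontrivialQuarticSolution f g) ∧
    (∀ n ∈ ({1, 2, 3, 5, 6, 7} : Set ℕ),
      ¬ ∃ f g : ℚ[X], f.natDegree = 2 ∧ g.natDegree = n ∧ IsQuarticSolution f g) ∧
    (∀ f g : ℚ[X], f.natDegree = 2 → g.natDegree = 4 →
      (IsQuarticSolution f g ↔
        g = quarticBaseP.comp f ∨ g = -quarticBaseP.comp f ∨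
        g = quarticBaseP.comp (-f) ∨ g = -quarticBaseP.comp (-f))) ∧
    (∀ f g : ℚ[X], f.natDegree = 2 → g.natDegree = 8 →
      (IsQuarticSolution f g ↔
        g = quarticBaseQ.comp f ∨ g = -quarticBaseQ.comp f)) := by
  have degP : ∀ f g : ℚ[X], f.natDegree = 2 →
      (g = quarticBaseP.comp f ∨ g = -quarticBaseP.comp f ∨
        g = quarticBaseP.comp (-f) ∨ g = -quarticBaseP.comp (-f)) → g.natDegree = 4 := by
    rintro f g hf (rfl | rfl | rfl | rfl) <;>
      simp [natDegree_comp, natDegree_quarticBaseP, hf]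
  have degQ : ∀ f g : ℚ[X], f.natDegree = 2 →
      (g = quarticBaseQ.comp f ∨ g = -quarticBaseQ.comp f) → g.natDegree = 8 := by
    rintro f g hf (rfl | rfl) <;> simp [natDegree_comp, natDegree_quarticBaseQ, hf]
  refine ⟨?_, ?_, fun f g hf hg ↦ ⟨fun h ↦ ?_, ?_⟩, fun f g hf hg ↦ ⟨fun h ↦ ?_, ?_⟩⟩
  · rintro ⟨f, g, hf, h⟩
    have hcomp : ∃ g₁ : ℚ[X], g = g₁.comp f := by
      rcases (h.solution.isListedPartner hf).eq_base with
        ⟨k, rfl⟩ | (rfl | rfl | rfl | rfl) | (rfl | rfl)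
      · exact ⟨C k, by simp⟩
      · exact ⟨quarticBaseP, rfl⟩
      · exact ⟨-quarticBaseP, by simp⟩
      · exact ⟨quarticBaseP.comp (-X), by simp [comp_assoc]⟩
      · exact ⟨-quarticBaseP.comp (-X), by simp [comp_assoc]⟩
      · exact ⟨quarticBaseQ, rfl⟩
      · exact ⟨-quarticBaseQ, by simp⟩
    obtain ⟨g₁, hg⟩ := hcomp
    exact h.not_composition ⟨X, g₁, f, hf.ge, by simp, hg⟩
  · rintro n hn ⟨f, g, hf, rfl, h⟩
    simp only [Set.mem_insert_iff, Set.mem_singleton_iff] at hn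
    rcases (h.isListedPartner hf).eq_base with ⟨k, rfl⟩ | h | h
    · simp at hn
    · have := degP f g hf h
      omega
    · have := degQ f g hf h
      omega
  · rcases (h.isListedPartner hf).eq_base with ⟨k, rfl⟩ | h | h
    · simp at hg
    · exact h
    · have := degQ f g hf h
      omega
  · rintro (rfl | rfl | rfl | rfl)
    · exact isQuarticSolution_baseP f
    · exact (isQuarticSolution_baseP f).neg_right
    · simpa using (isQuarticSolution_baseP (-f)).neg_left
    · simpa using (isQuarticSolution_baseP (-f)).neg_left.neg_right
  · rcases (h.isListedPartner hf).eq_base with ⟨k, rfl⟩ | h | h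
    · simp at hg
    · have := degP f g hf h
      omega
    · exact h
  · rintro (rfl | rfl)
    · exact isQuarticSolution_baseQ f
    · exact (isQuarticSolution_baseQ f).neg_right
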